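/- Let $\mathcal H$ be a complex Hilbert space (scalar product linear in the second variable) and let $q\in[-1,1]$. On the tensor powers define $\lambda_0=\mathbf 1_{\mathbb C}$, $\lambda_1=\mathbf 1_{\mathcal H}$, $\lambda_2(f\otimes g)=f\otimes g+q\,g\otimes f$ (extended linearly), and $\lambda_{n+2}=\mathbf 1_{\mathcal H}^{\otimes n}\otimes\lambda_2$ for $n\ge1$. Let $\mathcal H_n$ be the completion of the quotient of $\mathcal H^{\otimes n}$ by the null vectors of the semi-inner product $\langle F,G\rangle_n=\langle F,\lambda_nG\rangle_{\otimes n}$ (so $\mathcal H_0=\mathbb C$, $\mathcal H_1=\mathcal H$). The $(\mathbf q,2)$-Fock space is the Hilbert direct sum $\Gamma_{q,2}(\mathcal H)=\bigoplus_{n\ge0}\mathcal H_n$, with vacuum vector $\Phi=1\oplus0\oplus0\oplus\cdots$. For $f\in\mathcal H$ let $A^+(f)$ be the bounded operator on $\Gamma_{q,2}(\mathcal H)$ with $A^+(f)\Phi=f$ and $A^+(f)F=f\otimes F$ for $F\in\mathcal H_n$, $n\ge1$; let $A(f)=A^+(f)^*$ and $Q(f)=A(f)+A^+(f)$, a bounded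 self-adjoint operator. The vacuum distribution of $Q(f)$ is the probability measure $\mu$ on $\mathbb R$ such that every continuous $g:\mathbb R\to\mathbb R$ is $\mu$-integrable and $\int g\,d\mu=\langle\Phi,g(Q(f))\Phi\rangle$; in particular $\int x^n\,d\mu=\langle\Phi,Q(f)^n\Phi\rangle$ for all $n\ge 0$. **Proposition 3.1.** For every $0\ne f\in\mathcal H$, the vacuum distribution of $Q(f)$ is 1. the two-point law $\tfrac12\delta_{-\|f\|}+\tfrac12\delta_{\|f\|}$ if $q=-1$; 2. the semicircle law over $(-2\|f\|,2\|f\|)$, i.e. the measure with density $\frac{1}{2\pi\|f\|^2}\sqrt{4\|f\|^2-x^2}$ on that interval and $0$ outside it, if $q=0$. -/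

import Mathlib

open MeasureTheory
open scoped TensorProduct ENNReal InnerProductSpace

noncomputable section

namespace Q2Fock

universe u

/-! ### Algebraic tensor powers with the standard tensor scalar product -/

/-- A complex inner product space, bundled, so that tensor powers can be defined by recursion. -/
structure InnerSpace : Type (u + 1) where
  carrier : Type u
  [group : NormedAddCommGroup carrier]
  [innerProd : InnerProductSpace ℂ carrier]

attribute [instance] InnerSpace.group InnerSpace.innerProd

/-- The scalars `ℂ`, with their usual inner product, lifted to the universe `u`. -/
def scalars : InnerSpace.{u} :=
  letI : InnerProductSpace ℂ (ULift.{u} ℂ) :=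
    { inner := fun x y => inner ℂ x.down y.down
      norm_sq_eq_re_inner := fun x => norm_sq_eq_re_inner (𝕜 := ℂ) x.down
      conj_inner_symm := fun x y => inner_conj_symm x.down y.down
      add_left := fun x y z => inner_add_left x.down y.down z.down
      smul_left := fun x y r => inner_smul_left x.down y.down r }
  { carrier := ULift.{u} ℂ }

section

variable (H : Type u) [NormedAddCommGroup H] [InnerProductSpace ℂ H]

/-- The tensor powers `ℂ`, `H`, `H ⊗ H`, `H ⊗ (H ⊗ H)`, … with the standard tensor scalar product
`⟨f₁ ⊗ … ⊗ fₙ, g₁ ⊗ … ⊗ gₙ⟩ = ∏ ⟨fᵢ, gᵢ⟩` (conjugate-linear in the first variable). -/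
def tensorPow : ℕ → InnerSpace.{u}
  | 0 => scalars.{u}
  | 1 => { carrier := H }
  | n + 2 => { carrier := H ⊗[ℂ] (tensorPow (n + 1)).carrier }

/-- The underlying space of the `n`-th tensor power. -/
abbrev TPow (n : ℕ) : Type u := (tensorPow H n).carrier

variable {H}

/-- The operator `x ⊗ y ↦ s • x ⊗ y + t • y ⊗ x` on `H ⊗ H`. -/
def flipComb (s t : ℝ) : H ⊗[ℂ] H →ₗ[ℂ] H ⊗[ℂ] H :=
  (s : ℂ) • LinearMap.id + (t : ℂ) • (TensorProduct.comm ℂ H H).toLinearMap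

/-- The operator `1 ⊗ … ⊗ 1 ⊗ (s + t · flip)` on the `n`-th tensor power, the flip acting on the
last two tensor factors; for `n ≤ 1` it is the identity. -/
def lastTwo (s t : ℝ) : (n : ℕ) → TPow H n →ₗ[ℂ] TPow H n
  | 0 => LinearMap.id
  | 1 => LinearMap.id
  | 2 => flipComb (H := H) s t
  | n + 3 => LinearMap.lTensor H (lastTwo s t (n + 2))

/-- The operator `λₙ`: `λ₀ = 1`, `λ₁ = 1`, `λ₂ (f ⊗ g) = f ⊗ g + q g ⊗ f`, and
`λₙ₊₂ = 1 ⊗ … ⊗ 1 ⊗ λ₂`. -/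
def lam (q : ℝ) (n : ℕ) : TPow H n →ₗ[ℂ] TPow H n := lastTwo 1 q n

lemma inner_lTensor {E : Type*} [NormedAddCommGroup E] [InnerProductSpace ℂ E]
    (B : E →ₗ[ℂ] E) (hB : ∀ x y, inner ℂ (B x) y = inner ℂ x (B y)) (x y : H ⊗[ℂ] E) :
    inner ℂ (LinearMap.lTensor H B x) y = inner ℂ x (LinearMap.lTensor H B y) := by
  induction x using TensorProduct.induction_on with
  | zero => simp
  | add a b ha hb => simp only [map_add, inner_add_left, ha, hb]
  | tmul f F =>
    induction y using TensorProduct.induction_on with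
    | zero => simp
    | add a b ha hb => simp only [map_add, inner_add_right, ha, hb]
    | tmul g G => simp [hB]

lemma inner_flipComb (s t : ℝ) (x y : H ⊗[ℂ] H) :
    inner ℂ (flipComb s t x) y = inner ℂ x (flipComb s t y) := by
  induction x using TensorProduct.induction_on with
  | zero => simp
  | add a b ha hb => simp only [map_add, inner_add_left, ha, hb]
  | tmul f F =>
    induction y using TensorProduct.induction_on with
    | zero => simp
    | add a b ha hb => simp only [map_add, inner_add_right, ha, hb]
    | tmul g G =>
      simp only [flipComb, LinearMap.add_apply, LinearMap.smul_apply, LinearMap.id_apply,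
        LinearEquiv.coe_coe, TensorProduct.comm_tmul, inner_add_left, inner_add_right,
        inner_smul_left, inner_smul_right, TensorProduct.inner_tmul, Complex.conj_ofReal]
      ring

lemma inner_lastTwo (s t : ℝ) : ∀ (n : ℕ) (x y : TPow H n),
    inner ℂ (lastTwo s t n x) y = inner ℂ x (lastTwo s t n y)
  | 0, _, _ => rfl
  | 1, _, _ => rfl
  | 2, x, y => inner_flipComb (H := H) s t x y
  | n + 3, x, y => inner_lTensor (H := H) (lastTwo s t (n + 2)) (inner_lastTwo s t (n + 2)) x y

lemma flipComb_flipComb (s t : ℝ) (x : H ⊗[ℂ] H) :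
    flipComb s t (flipComb s t x) = flipComb (s ^ 2 + t ^ 2) (2 * s * t) x := by
  induction x using TensorProduct.induction_on with
  | zero => simp
  | add a b ha hb => simp only [map_add, ha, hb]
  | tmul f g =>
    simp only [flipComb, LinearMap.add_apply, LinearMap.smul_apply, LinearMap.id_apply, map_add,
      map_smul, LinearEquiv.coe_coe, TensorProduct.comm_tmul]
    push_cast
    module

lemma lastTwo_lastTwo (s t : ℝ) : ∀ (n : ℕ), 2 ≤ n → ∀ x : TPow H n,
    lastTwo s t n (lastTwo s t n x) = lastTwo (s ^ 2 + t ^ 2) (2 * s * t) n x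
  | 0, h, _ => by omega
  | 1, h, _ => by omega
  | 2, _, x => flipComb_flipComb (H := H) s t x
  | n + 3, _, x => by
    have ih : lastTwo (H := H) s t (n + 2) ∘ₗ lastTwo s t (n + 2)
        = lastTwo (s ^ 2 + t ^ 2) (2 * s * t) (n + 2) :=
      LinearMap.ext (lastTwo_lastTwo s t (n + 2) (by omega))
    change (LinearMap.lTensor H (lastTwo s t (n + 2)))
      ((LinearMap.lTensor H (lastTwo s t (n + 2))) x) =
        LinearMap.lTensor H (lastTwo (s ^ 2 + t ^ 2) (2 * s * t) (n + 2)) x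
    rw [← ih, LinearMap.lTensor_comp]
    rfl

/-- Positivity of `λₙ` for `q ∈ [-1, 1]`. -/
lemma re_inner_lam_nonneg (q : Set.Icc (-1 : ℝ) 1) (n : ℕ) (x : TPow H n) :
    0 ≤ RCLike.re (inner ℂ x (lam (q : ℝ) n x)) := by
  have hle : ∀ n, n < 2 → ∀ x : TPow H n, lam (q : ℝ) n x = x := by
    intro n hn x
    interval_cases n <;> rfl
  rcases lt_or_ge n 2 with hn | hn
  · rw [hle n hn x]; exact inner_self_nonneg
  · obtain ⟨q, hq1, hq2⟩ := q
    have h1 : √(1 + q) ^ 2 = 1 + q := Real.sq_sqrt (by linarith)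
    have h2 : √(1 - q) ^ 2 = 1 - q := Real.sq_sqrt (by linarith)
    have key := lastTwo_lastTwo (H := H) ((√(1 + q) + √(1 - q)) / 2) ((√(1 + q) - √(1 - q)) / 2)
      n hn x
    rw [show ((√(1 + q) + √(1 - q)) / 2) ^ 2 + ((√(1 + q) - √(1 - q)) / 2) ^ 2 = 1 by nlinarith,
      show 2 * ((√(1 + q) + √(1 - q)) / 2) * ((√(1 + q) - √(1 - q)) / 2) = q by nlinarith] at key
    change 0 ≤ RCLike.re (inner ℂ x (lastTwo 1 q n x))
    rw [← key, ← inner_lastTwo]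
    exact inner_self_nonneg

/-! ### The `n`-particle spaces and the Fock space -/

variable (H)

/-- The `n`-th tensor power, regarded with the semi-inner product `⟨F, G⟩ₙ = ⟨F, λₙ G⟩`. -/
def PreParticle (_q : Set.Icc (-1 : ℝ) 1) (n : ℕ) : Type u := TPow H n

variable (q : Set.Icc (-1 : ℝ) 1) (n : ℕ)

/-- The semi-inner product `⟨F, G⟩ₙ = ⟨F, λₙ G⟩`. -/
@[reducible]
def preCore : PreInnerProductSpace.Core ℂ (TPow H n) where
  inner F G := inner ℂ F (lam (q : ℝ) n G)
  conj_inner_symm F G := by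
    rw [inner_conj_symm]
    exact inner_lastTwo 1 (q : ℝ) n F G
  re_inner_nonneg F := re_inner_lam_nonneg q n F
  add_left F G K := inner_add_left F G _
  smul_left F G r := inner_smul_left F _ r

instance : SeminormedAddCommGroup (PreParticle H q n) :=
  @InnerProductSpace.Core.toSeminormedAddCommGroup ℂ (TPow H n) _ _ _ (preCore H q n)

instance : InnerProductSpace ℂ (PreParticle H q n) :=
  InnerProductSpace.ofCore (preCore H q n)

/-- The `n`-particle space `𝓗ₙ`: the Hausdorff completion of the `n`-th tensor power for the
semi-inner product `⟨F, λₙ G⟩`, that is, the completion of its quotient by the null vectors. -/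
def Particle : Type u := UniformSpace.Completion (PreParticle H q n)

instance : NormedAddCommGroup (Particle H q n) :=
  inferInstanceAs (NormedAddCommGroup (UniformSpace.Completion (PreParticle H q n)))

instance : InnerProductSpace ℂ (Particle H q n) :=
  inferInstanceAs (InnerProductSpace ℂ (UniformSpace.Completion (PreParticle H q n)))

instance : CompleteSpace (Particle H q n) :=
  inferInstanceAs (CompleteSpace (UniformSpace.Completion (PreParticle H q n)))

/-- The `(q,2)`-Fock space, the Hilbert direct sum of the `n`-particle spaces, `n ≥ 0`. -/
def Fock : Type u := lp (fun n : ℕ => Particle H q n) 2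

instance : NormedAddCommGroup (Fock H q) :=
  inferInstanceAs (NormedAddCommGroup (lp (fun n : ℕ => Particle H q n) 2))

instance : InnerProductSpace ℂ (Fock H q) :=
  inferInstanceAs (InnerProductSpace ℂ (lp (fun n : ℕ => Particle H q n) 2))

instance : CompleteSpace (Fock H q) :=
  inferInstanceAs (CompleteSpace (lp (fun n : ℕ => Particle H q n) 2))

/-- The identity map, from the Fock space to the Hilbert sum that defines it. -/
def fockEquiv : Fock H q ≃ₗᵢ[ℂ] lp (fun n : ℕ => Particle H q n) 2 where
  toFun F := F
  invFun F := F
  left_inv _ := rfl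
  right_inv _ := rfl
  map_add' _ _ := rfl
  map_smul' _ _ := rfl
  norm_map' _ := rfl

variable {H}

/-- The identity map from the `n`-th tensor power to itself, the target carrying the semi-inner
product `⟨F, λₙ G⟩`. -/
def toPre : TPow H n ≃ₗ[ℂ] PreParticle H q n where
  toFun F := F
  invFun F := F
  left_inv _ := rfl
  right_inv _ := rfl
  map_add' _ _ := rfl
  map_smul' _ _ := rfl

lemma inner_toPre (F G : TPow H n) :
    inner ℂ (toPre q n F) (toPre q n G) = inner ℂ F (lam (q : ℝ) n G) := rfl

/-- The canonical map of a tensor power, with its semi-inner product, to its completion. -/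
def coeParticle : PreParticle H q n →L[ℂ] Particle H q n :=
  (UniformSpace.Completion.toComplL :
    PreParticle H q n →L[ℂ] UniformSpace.Completion (PreParticle H q n))

/-- The class in `𝓗ₙ` of an element of the `n`-th tensor power. -/
def toParticle : TPow H n →ₗ[ℂ] Particle H q n :=
  (coeParticle q n).toLinearMap ∘ₗ (toPre q n).toLinearMap

lemma inner_toParticle (F G : TPow H n) :
    inner ℂ (toParticle q n F) (toParticle q n G) = inner ℂ F (lam (q : ℝ) n G) :=
  UniformSpace.Completion.inner_coe (𝕜 := ℂ) (toPre q n F) (toPre q n G)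

variable (H) in
/-- The scalar `1`, as an element of the zeroth tensor power `ℂ`. -/
def unit : TPow H 0 := (ULift.up 1 : ULift.{u} ℂ)

variable (H) in
/-- The vacuum vector `Φ = 1 ⊕ 0 ⊕ 0 ⊕ …`. -/
def vacuum : Fock H q :=
  (fockEquiv H q).symm (lp.single 2 0 (toParticle q 0 (unit H)))

/-! ### Creation, annihilation and field operators -/

/-- `c ↦ c f` on scalars, and `F ↦ f ⊗ F` on the `n`-th tensor power for `n ≥ 1`. -/
def tensorLeft (f : H) : (n : ℕ) → TPow H n →ₗ[ℂ] TPow H (n + 1)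
  | 0 => (LinearMap.toSpanSingleton ℂ H f).comp
      (ULift.moduleEquiv (R := ℂ) (M := ℂ)).toLinearMap
  | n + 1 => TensorProduct.mk ℂ H (TPow H (n + 1)) f

/-- `tensorLeft`, between the tensor powers with their semi-inner products. -/
def preCreation (f : H) : PreParticle H q n →ₗ[ℂ] PreParticle H q (n + 1) :=
  (toPre q (n + 1)).toLinearMap ∘ₗ tensorLeft f n ∘ₗ (toPre q n).symm.toLinearMap

lemma norm_sq_toPre (F : TPow H n) :
    ‖toPre q n F‖ ^ 2 = RCLike.re (inner ℂ F (lam (q : ℝ) n F)) :=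
  norm_sq_eq_re_inner (𝕜 := ℂ) (toPre q n F)

lemma norm_sq_tensorLeft_le (f : H) : ∀ (n : ℕ) (F : TPow H n),
    ‖toPre q (n + 1) (tensorLeft f n F)‖ ^ 2 ≤ 2 * (‖f‖ ^ 2 * ‖toPre q n F‖ ^ 2)
  | 0, F => by
    rw [norm_sq_toPre, norm_sq_toPre]
    change RCLike.re (inner ℂ (F.down • f) (F.down • f))
      ≤ 2 * (‖f‖ ^ 2 * RCLike.re (inner ℂ F.down F.down))
    rw [← norm_sq_eq_re_inner, ← norm_sq_eq_re_inner, norm_smul]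
    nlinarith [sq_nonneg (‖F.down‖ * ‖f‖)]
  | 1, F => by
    rw [norm_sq_toPre, norm_sq_toPre]
    change H at F
    change RCLike.re (inner ℂ (f ⊗ₜ[ℂ] F) (flipComb 1 (q : ℝ) (f ⊗ₜ[ℂ] F)))
      ≤ 2 * (‖f‖ ^ 2 * RCLike.re (inner ℂ F F))
    have hq := q.2
    rw [Set.mem_Icc, ← abs_le] at hq
    rw [← norm_sq_eq_re_inner]
    refine (RCLike.re_le_norm _).trans ((norm_inner_le_norm (𝕜 := ℂ) (f ⊗ₜ[ℂ] F)
      (flipComb 1 (q : ℝ) (f ⊗ₜ[ℂ] F))).trans ?_)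
    have h1 : ‖flipComb 1 (q : ℝ) (f ⊗ₜ[ℂ] F)‖ ≤ 2 * (‖f‖ * ‖F‖) := by
      simp only [flipComb, LinearMap.add_apply, LinearMap.smul_apply, LinearMap.id_apply,
        LinearEquiv.coe_coe, TensorProduct.comm_tmul]
      refine (norm_add_le _ _).trans ?_
      rw [norm_smul, norm_smul, TensorProduct.norm_tmul, TensorProduct.norm_tmul,
        Complex.norm_real, Complex.norm_real, Real.norm_eq_abs, Real.norm_eq_abs, abs_one]
      have : 0 ≤ ‖f‖ * ‖F‖ := by positivity
      nlinarith
    rw [TensorProduct.norm_tmul]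
    have : 0 ≤ ‖f‖ * ‖F‖ := by positivity
    nlinarith
  | n + 2, F => by
    rw [norm_sq_toPre, norm_sq_toPre]
    change RCLike.re (inner ℂ (f ⊗ₜ[ℂ] F) (f ⊗ₜ[ℂ] (lam (q : ℝ) (n + 2) F)))
      ≤ 2 * (‖f‖ ^ 2 * RCLike.re (inner ℂ F (lam (q : ℝ) (n + 2) F)))
    rw [TensorProduct.inner_tmul, inner_self_eq_norm_sq_to_K]
    have h0 := re_inner_lam_nonneg q (n + 2) F
    have h1 : RCLike.re (((‖f‖ : ℂ) ^ 2) * inner ℂ F (lam (q : ℝ) (n + 2) F))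
        = ‖f‖ ^ 2 * RCLike.re (inner ℂ F (lam (q : ℝ) (n + 2) F)) := by
      rw [← Complex.ofReal_pow]
      exact Complex.re_ofReal_mul _ _
    refine h1.le.trans ?_
    nlinarith [mul_nonneg (sq_nonneg ‖f‖) h0]

lemma norm_preCreation_le (f : H) (x : PreParticle H q n) :
    ‖preCreation q n f x‖ ≤ 2 * ‖f‖ * ‖x‖ := by
  have h := norm_sq_tensorLeft_le q f n ((toPre q n).symm x)
  rw [LinearEquiv.apply_symm_apply] at h
  refine le_of_sq_le_sq ?_ (by positivity)
  refine h.trans ?_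
  nlinarith [mul_nonneg (sq_nonneg ‖f‖) (sq_nonneg ‖x‖)]

/-- The creation operator `F ↦ f ⊗ F` from `𝓗ₙ` to `𝓗ₙ₊₁` (from `ℂ` to `H`, `c ↦ c f`, if
`n = 0`), extended from the tensor power by continuity. -/
def creationAt (f : H) : Particle H q n →L[ℂ] Particle H q (n + 1) :=
  (((preCreation q n f).mkContinuous (2 * ‖f‖) (norm_preCreation_le q n f)).completion :
    UniformSpace.Completion (PreParticle H q n) →L[ℂ]
      UniformSpace.Completion (PreParticle H q (n + 1)))

lemma creationAt_toParticle (f : H) (F : TPow H n) :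
    creationAt q n f (toParticle q n F) = toParticle q (n + 1) (tensorLeft f n F) :=
  ContinuousLinearMap.completion_apply_coe
    ((preCreation q n f).mkContinuous (2 * ‖f‖) (norm_preCreation_le q n f)) (toPre q n F)

lemma norm_creationAt_le (f : H) (x : Particle H q n) :
    ‖creationAt q n f x‖ ≤ 2 * ‖f‖ * ‖x‖ := by
  change UniformSpace.Completion (PreParticle H q n) at x
  let T := ((preCreation q n f).mkContinuous (2 * ‖f‖) (norm_preCreation_le q n f)).completion
  change ‖T x‖ ≤ 2 * ‖f‖ * ‖x‖
  induction x using UniformSpace.Completion.induction_on with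
  | hp => exact isClosed_le (by fun_prop) (by fun_prop)
  | ih a =>
    rw [ContinuousLinearMap.completion_apply_coe, UniformSpace.Completion.norm_coe,
      UniformSpace.Completion.norm_coe]
    exact norm_preCreation_le q n f a

/-- The sequence `(0, f ⊗ F₀, f ⊗ F₁, …)`. -/
def creationSeq (f : H) (F : (n : ℕ) → Particle H q n) : (n : ℕ) → Particle H q n
  | 0 => 0
  | n + 1 => creationAt q n f (F n)

lemma sum_creationSeq_le (f : H) (F : lp (fun n : ℕ => Particle H q n) 2) (s : Finset ℕ) :
    ∑ n ∈ s, ‖creationSeq q f F n‖ ^ (2 : ℝ≥0∞).toReal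
      ≤ (2 * ‖f‖ * ‖F‖) ^ (2 : ℝ≥0∞).toReal := by
  have hs : s ⊆ Finset.range (s.sup id + 1) := fun n hn =>
    Finset.mem_range.2 (Nat.lt_succ_of_le (Finset.le_sup (f := id) hn))
  refine (Finset.sum_le_sum_of_subset_of_nonneg hs fun _ _ _ => by positivity).trans ?_
  rw [Finset.sum_range_succ']
  have hF := lp.sum_rpow_le_norm_rpow (p := 2) (by norm_num) F (Finset.range (s.sup id))
  have h0 : ‖creationSeq q f F 0‖ ^ (2 : ℝ≥0∞).toReal = 0 := by simp [creationSeq]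
  rw [h0, add_zero, Real.mul_rpow (by positivity) (by positivity)]
  refine le_trans ?_ (mul_le_mul_of_nonneg_left hF (by positivity))
  rw [Finset.mul_sum]
  refine Finset.sum_le_sum fun n _ => ?_
  rw [← Real.mul_rpow (by positivity) (by positivity)]
  exact Real.rpow_le_rpow (norm_nonneg _) (norm_creationAt_le q n f (F n)) (by positivity)

/-- The operator `(F₀, F₁, …) ↦ (0, f ⊗ F₀, f ⊗ F₁, …)` on the Hilbert sum. -/
def creationLp (f : H) :
    lp (fun n : ℕ => Particle H q n) 2 →L[ℂ] lp (fun n : ℕ => Particle H q n) 2 :=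
  LinearMap.mkContinuous
    { toFun := fun F => ⟨creationSeq q f F, memℓp_gen' (sum_creationSeq_le q f F)⟩
      map_add' := fun F G => by
        ext n
        cases n with
        | zero => exact (add_zero 0).symm
        | succ n => exact map_add (creationAt q n f) (F n) (G n)
      map_smul' := fun c F => by
        ext n
        cases n with
        | zero => simp [creationSeq]
        | succ n => simp [creationSeq] }
    (2 * ‖f‖)
    (fun F => lp.norm_le_of_forall_sum_le (by norm_num) (by positivity)
      (sum_creationSeq_le q f F))

/-- The creation operator `A⁺(f)` on the Fock space: `A⁺(f) Φ = f` and `A⁺(f) F = f ⊗ F`. -/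
def creation (f : H) : Fock H q →L[ℂ] Fock H q :=
  (fockEquiv H q).symm.toLinearIsometry.toContinuousLinearMap ∘L creationLp q f ∘L
    (fockEquiv H q).toLinearIsometry.toContinuousLinearMap

/-- The annihilation operator `A(f) = A⁺(f)*`. -/
def annihilation (f : H) : Fock H q →L[ℂ] Fock H q :=
  ContinuousLinearMap.adjoint (creation q f)

/-- The field operator `Q(f) = A(f) + A⁺(f)`. -/
def field (f : H) : Fock H q →L[ℂ] Fock H q :=
  annihilation q f + creation q f

lemma isSelfAdjoint_field (f : H) : IsSelfAdjoint (field q f) := by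
  rw [isSelfAdjoint_iff, field, annihilation, star_add, ← ContinuousLinearMap.star_eq_adjoint,
    star_star, add_comm]

end

/-! ### Distributions -/

/-- `μ` is the distribution of the bounded self-adjoint operator `T` in the vector state given by
the unit vector `Φ`: the probability measure on `ℝ` with `⟨Φ, g(T) Φ⟩ = ∫ g dμ` for every
continuous `g`, where `g(T)` is the continuous functional calculus. In particular all moments
`∫ xⁿ dμ = ⟨Φ, Tⁿ Φ⟩` are included. -/
structure IsDistribution {E : Type*} [NormedAddCommGroup E] [InnerProductSpace ℂ E]
    [CompleteSpace E] (T : E →L[ℂ] E) (Φ : E) (μ : Measure ℝ) : Prop where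
  norm_eq_one : ‖Φ‖ = 1
  isSelfAdjoint : IsSelfAdjoint T
  isProbabilityMeasure : IsProbabilityMeasure μ
  integrable : ∀ g : ℝ → ℝ, Continuous g → Integrable g μ
  integral_eq : ∀ g : ℝ → ℝ, Continuous g → ((∫ x, g x ∂μ : ℝ) : ℂ) = inner ℂ Φ (cfc g T Φ)

/-- The two-point law on `{-r, r}` with probabilities `1/2`. -/
def twoPointLaw (r : ℝ) : Measure ℝ :=
  (1 / 2 : ℝ≥0∞) • Measure.dirac (-r) + (1 / 2 : ℝ≥0∞) • Measure.dirac r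

/-- The semicircle law over `(-r, r)`, with density `2 / (π r²) · √(r² - x²)` on that interval. -/
def semicircleLaw (r : ℝ) : Measure ℝ :=
  volume.withDensity fun x =>
    ENNReal.ofReal ((Set.Ioo (-r) r).indicator
      (fun x => 2 / (Real.pi * r ^ 2) * √(r ^ 2 - x ^ 2)) x)

end Q2Fock

end

namespace Q2Fock

/-! ### Distributions are determined by their moments -/

/-! Both laws have compact support, so by Weierstrass it suffices to match moments with `⟨Φ, Q(f)ⁿ
Φ⟩`. Write `eₙ` for the class of `f ⊗ … ⊗ f` (`n` factors), so `e₀ = Φ`, `A⁺(f) eₙ = eₙ₊₁` and `A(f)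
Φ = 0`. In both cases the orbit of the vacuum under `Q(f)` stays in the span of the `eₙ`.

If `q = -1`, then `λ₂ (f ⊗ f) = 0`, so `e₂ = 0` and `Q(f)² Φ = ‖f‖² Φ`. Even moments are powers of
`‖f‖`, and odd ones vanish because `e₁ ⟂ Φ`: these are the moments of the two-point law.

If `q = 0`, every `λₙ` is the identity and `A(f) eₙ₊₁ = ‖f‖² eₙ`. Hence `Q(f) eₙ₊₁ = eₙ₊₂ + ‖f‖²
eₙ`, the recurrence of the Chebyshev polynomials of the second kind. With `x = 2‖f‖ cos θ`, the
vector `eₙ` corresponds to `‖f‖ⁿ sin((n+1)θ) / sin θ`, the operator `Q(f)` to multiplication by `x`,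
and the vacuum state to integration against `(2/π) sin² θ dθ` on `[0, π]`, which is the semicircle
law in the variable `θ`. This is `inner_vacuum_field_pow_of_eq_zero`, with `integral_semicircleLaw`
for the change of variable. -/

/-- Linearity passes from monomials to polynomials. A continuous `g` is then approximated uniformly
by a polynomial, which controls the integral and the functional calculus at once. -/
lemma IsDistribution.of_moments {E : Type*} [NormedAddCommGroup E] [InnerProductSpace ℂ E]
    [CompleteSpace E] {T : E →L[ℂ] E} {Φ : E} {μ : Measure ℝ} (hΦ : ‖Φ‖ = 1)
    (hT : IsSelfAdjoint T) (hμ : IsProbabilityMeasure μ) {R : ℝ}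
    (hR : ∀ᵐ x ∂μ, x ∈ Set.Icc (-R) R)
    (hmom : ∀ n : ℕ, ((∫ x, x ^ n ∂μ : ℝ) : ℂ) = inner ℂ Φ ((T ^ n) Φ)) :
    IsDistribution T Φ μ := by
  have hne : Nontrivial E := ⟨Φ, 0, fun h => by simp [h] at hΦ⟩
  have hint : ∀ g : ℝ → ℝ, Continuous g → Integrable g μ := by
    intro g hg
    obtain ⟨C, hC⟩ := (isCompact_Icc (a := -R) (b := R)).exists_bound_of_continuousOn
      hg.continuousOn
    refine Integrable.of_bound hg.aestronglyMeasurable C ?_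
    filter_upwards [hR] with x hx using hC x hx
  have hpoly : ∀ p : Polynomial ℝ,
      ((∫ x, p.eval x ∂μ : ℝ) : ℂ) = inner ℂ Φ (Polynomial.aeval T p Φ) := by
    intro p
    induction p using Polynomial.induction_on' with
    | add p r hp hr =>
      simp only [Polynomial.eval_add, map_add, add_apply, inner_add_right]
      rw [integral_add (hint _ p.continuous) (hint _ r.continuous), ← hp, ← hr]
      push_cast
      rfl
    | monomial n a =>
      simp only [Polynomial.eval_monomial, Polynomial.aeval_monomial]
      rw [integral_const_mul, Complex.ofReal_mul, hmom n, ← Algebra.smul_def,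
        smul_apply, ← Complex.coe_smul, inner_smul_right]
  refine ⟨hΦ, hT, hμ, hint, fun g hg => ?_⟩
  -- `[-S, S]` contains both the support of `μ` and the spectrum of `T`, so one approximating
  -- polynomial serves both sides.
  set S := max R ‖T‖
  refine eq_of_forall_dist_le fun ε hε => ?_
  obtain ⟨p, hp⟩ := exists_polynomial_near_of_continuousOn (-S) S g hg.continuousOn (ε / 2)
    (by positivity)
  have h1 : ‖(∫ x, g x ∂μ) - ∫ x, p.eval x ∂μ‖ ≤ ε / 2 := by
    rw [← integral_sub (hint g hg) (hint _ p.continuous)]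
    have := norm_integral_le_of_norm_le_const (μ := μ) (f := fun x => g x - p.eval x)
      (C := ε / 2) (by
        filter_upwards [hR] with x hx
        have hS : R ≤ S := le_max_left _ _
        have hx' : x ∈ Set.Icc (-S) S := ⟨by linarith [hx.1], hx.2.trans hS⟩
        rw [norm_sub_rev]
        exact (hp x hx').le)
    simpa using this
  have h2 : ‖cfc (fun x => p.eval x - g x) T‖ ≤ ε / 2 := by
    refine norm_cfc_le (by positivity) fun x hx => ?_
    have hxT := spectrum.norm_le_norm_of_mem hx
    exact (hp x (abs_le.1 (hxT.trans (le_max_right _ _)))).le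
  rw [cfc_sub _ _ T p.continuous.continuousOn hg.continuousOn, cfc_polynomial p T hT] at h2
  have h3 : ‖inner ℂ Φ ((Polynomial.aeval T p - cfc g T) Φ)‖ ≤ ε / 2 := by
    refine (norm_inner_le_norm _ _).trans ?_
    have := (Polynomial.aeval T p - cfc g T).le_opNorm Φ
    rw [hΦ] at this ⊢
    linarith
  rw [sub_apply, inner_sub_right, ← hpoly] at h3
  rw [← Complex.norm_real] at h1
  push_cast at h1
  rw [dist_eq_norm]
  calc _ = ‖(((∫ x, g x ∂μ : ℝ) : ℂ) - ((∫ x, p.eval x ∂μ : ℝ) : ℂ))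
        + (((∫ x, p.eval x ∂μ : ℝ) : ℂ) - inner ℂ Φ (cfc g T Φ))‖ := by congr 1; ring
    _ ≤ ε / 2 + ε / 2 := (norm_add_le _ _).trans (add_le_add h1 h3)
    _ = ε := by ring

/-! ### The two laws -/

lemma isProbabilityMeasure_twoPointLaw (r : ℝ) : IsProbabilityMeasure (twoPointLaw r) :=
  ⟨by simp [twoPointLaw, ENNReal.inv_two_add_inv_two]⟩

lemma integral_twoPointLaw (r : ℝ) (g : ℝ → ℝ) :
    ∫ x, g x ∂twoPointLaw r = (g (-r) + g r) / 2 := by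
  rw [twoPointLaw, integral_add_measure ((integrable_dirac (by simp)).smul_measure (by simp))
    ((integrable_dirac (by simp)).smul_measure (by simp))]
  simp only [integral_smul_measure, integral_dirac]
  simp
  ring

lemma ae_twoPointLaw {r : ℝ} (hr : 0 ≤ r) : ∀ᵐ x ∂twoPointLaw r, x ∈ Set.Icc (-r) r := by
  have h := neg_le_self hr
  simp only [twoPointLaw, ae_add_measure_iff]
  exact ⟨Measure.ae_smul_measure ((ae_dirac_iff measurableSet_Icc).2 ⟨le_rfl, h⟩) _,
    Measure.ae_smul_measure ((ae_dirac_iff measurableSet_Icc).2 ⟨h, le_rfl⟩) _⟩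

/-- The density of the semicircle law over `(-r, r)`. -/
noncomputable def semicircleDensity (r x : ℝ) : ℝ :=
  (Set.Ioo (-r) r).indicator (fun x => 2 / (Real.pi * r ^ 2) * √(r ^ 2 - x ^ 2)) x

lemma measurable_semicircleDensity (r : ℝ) : Measurable (semicircleDensity r) :=
  (Continuous.measurable (by fun_prop)).indicator measurableSet_Ioo

lemma semicircleDensity_nonneg (r x : ℝ) : 0 ≤ semicircleDensity r x :=
  Set.indicator_nonneg (fun _ _ => by positivity) x

lemma semicircleLaw_eq (r : ℝ) :
    semicircleLaw r = volume.withDensity fun x => ENNReal.ofReal (semicircleDensity r x) := rfl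

lemma ae_semicircleLaw (r : ℝ) : ∀ᵐ x ∂semicircleLaw r, x ∈ Set.Icc (-r) r := by
  rw [semicircleLaw_eq, ae_withDensity_iff (measurable_semicircleDensity r).ennreal_ofReal]
  refine Filter.Eventually.of_forall fun x hx => ?_
  by_contra hxr
  exact hx (by rw [semicircleDensity, Set.indicator_of_notMem
    (fun h => hxr (Set.Ioo_subset_Icc_self h)), ENNReal.ofReal_zero])

/-- Substitute `x = r cos θ`: the square root becomes `r sin θ`, and the sign of `dx = -r sin θ dθ`
is absorbed by the reversed orientation. -/
lemma integral_semicircleDensity_mul {r : ℝ} (hr : 0 < r) {g : ℝ → ℝ} (hg : Continuous g) :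
    ∫ x, semicircleDensity r x * g x
      = 2 / Real.pi * ∫ θ in 0..Real.pi, g (r * Real.cos θ) * Real.sin θ ^ 2 := by
  have hind : (fun x => semicircleDensity r x * g x) = (Set.Ioo (-r) r).indicator
      (fun x => 2 / (Real.pi * r ^ 2) * √(r ^ 2 - x ^ 2) * g x) := by
    ext x
    by_cases hx : x ∈ Set.Ioo (-r) r <;> simp [semicircleDensity, hx]
  rw [hind, integral_indicator measurableSet_Ioo, ← integral_Ioc_eq_integral_Ioo,
    ← intervalIntegral.integral_of_le (by linarith), intervalIntegral.integral_symm]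
  have hsub := intervalIntegral.integral_comp_mul_deriv (a := 0) (b := Real.pi)
    (f := fun θ => r * Real.cos θ) (f' := fun θ => r * (-Real.sin θ))
    (g := fun x => 2 / (Real.pi * r ^ 2) * √(r ^ 2 - x ^ 2) * g x)
    (fun θ _ => (Real.hasDerivAt_cos θ).const_mul r) (by fun_prop) (by fun_prop)
  simp only [Real.cos_zero, mul_one, Real.cos_pi, mul_neg, Function.comp_apply] at hsub
  rw [← hsub, ← intervalIntegral.integral_neg, ← intervalIntegral.integral_const_mul]
  refine intervalIntegral.integral_congr fun θ hθ => ?_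
  rw [Set.uIcc_of_le Real.pi_pos.le] at hθ
  have hs := Real.sin_nonneg_of_mem_Icc hθ
  have hsq : √(r ^ 2 - (r * Real.cos θ) ^ 2) = r * Real.sin θ := by
    rw [← Real.sqrt_sq (mul_nonneg hr.le hs)]
    congr 1
    nlinarith [Real.sin_sq_add_cos_sq θ]
  simp only [hsq]
  field_simp

lemma integral_semicircleLaw {r : ℝ} (hr : 0 < r) {g : ℝ → ℝ} (hg : Continuous g) :
    ∫ x, g x ∂semicircleLaw r
      = 2 / Real.pi * ∫ θ in 0..Real.pi, g (r * Real.cos θ) * Real.sin θ ^ 2 := by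
  rw [← integral_semicircleDensity_mul hr hg, semicircleLaw_eq,
    integral_withDensity_eq_integral_toReal_smul
      (measurable_semicircleDensity r).ennreal_ofReal (by simp)]
  simp only [ENNReal.toReal_ofReal (semicircleDensity_nonneg r _), smul_eq_mul]

lemma isProbabilityMeasure_semicircleLaw {r : ℝ} (hr : 0 < r) :
    IsProbabilityMeasure (semicircleLaw r) := by
  have h1 : ∫ x, semicircleDensity r x = 1 := by
    have h := integral_semicircleDensity_mul hr (continuous_const (y := (1 : ℝ)))
    simp only [mul_one, one_mul] at h
    rw [h, integral_sin_sq]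
    simp
  -- Integrability comes for free: the integral of a non-integrable function is `0` by convention,
  -- whereas here it is `1`.
  have hi : Integrable (semicircleDensity r) := by
    by_contra h
    rw [integral_undef h] at h1
    exact zero_ne_one h1
  constructor
  rw [semicircleLaw_eq, withDensity_apply _ MeasurableSet.univ, Measure.restrict_univ,
    ← ofReal_integral_eq_lintegral_ofReal hi
      (Filter.Eventually.of_forall (semicircleDensity_nonneg r)), h1, ENNReal.ofReal_one]

/-- Orthogonality of the Chebyshev polynomials to the constant `1`. The product is a difference of
two cosines, and only `n = 0` leaves a constant term. -/
lemma integral_sin_succ_mul_sin (n : ℕ) :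
    ∫ θ in 0..Real.pi, Real.sin ((n + 1) * θ) * Real.sin θ
      = if n = 0 then Real.pi / 2 else 0 := by
  have hcos : ∀ k : ℕ, k ≠ 0 → ∫ θ in 0..Real.pi, Real.cos (k * θ) = 0 := by
    intro k hk
    rw [intervalIntegral.integral_comp_mul_left (f := Real.cos) (Nat.cast_ne_zero.2 hk),
      integral_cos]
    simp [Real.sin_nat_mul_pi]
  have hprod : ∀ θ : ℝ, Real.sin ((n + 1) * θ) * Real.sin θ
      = (Real.cos (n * θ) - Real.cos ((n + 2 : ℕ) * θ)) / 2 := by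
    intro θ
    rw [show (n : ℝ) * θ = (n + 1) * θ - θ by ring,
      show ((n + 2 : ℕ) : ℝ) * θ = (n + 1) * θ + θ by push_cast; ring,
      Real.cos_sub, Real.cos_add]
    ring
  simp only [hprod]
  rw [intervalIntegral.integral_div, intervalIntegral.integral_sub
    (Continuous.intervalIntegrable (by fun_prop) _ _)
    (Continuous.intervalIntegrable (by fun_prop) _ _), hcos (n + 2) (by omega)]
  split_ifs with h
  · simp [h]
  · simp [hcos n h]

end Q2Fock

namespace Q2Fock

/-! ### The field operator on the powers of one vector -/

section

universe u

variable {H : Type u} [NormedAddCommGroup H] [InnerProductSpace ℂ H] (q : Set.Icc (-1 : ℝ) 1)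

/-- The class in the Fock space of an element of the `n`-th tensor power. -/
noncomputable def toFock (n : ℕ) : TPow H n →ₗ[ℂ] Fock H q :=
  (fockEquiv H q).symm.toLinearEquiv.toLinearMap ∘ₗ
    lp.lsingle (𝕜 := ℂ) (E := fun n : ℕ => Particle H q n) 2 n ∘ₗ toParticle q n

lemma toFock_apply (n : ℕ) (x : TPow H n) :
    toFock q n x = (fockEquiv H q).symm (lp.single 2 n (toParticle q n x)) := rfl

lemma vacuum_eq_toFock : vacuum H q = toFock q 0 (unit H) := rfl

lemma inner_toFock_right (w : Fock H q) (n : ℕ) (x : TPow H n) :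
    inner ℂ w (toFock q n x) = inner ℂ (fockEquiv H q w n) (toParticle q n x) :=
  lp.inner_single_right (𝕜 := ℂ) n (toParticle q n x) (fockEquiv H q w)

lemma inner_toFock_of_ne {m n : ℕ} (h : m ≠ n) (x : TPow H m) (y : TPow H n) :
    inner ℂ (toFock q m x) (toFock q n y) = 0 := by
  rw [inner_toFock_right, toFock_apply, LinearIsometryEquiv.apply_symm_apply,
    lp.single_apply_ne _ _ _ h.symm, inner_zero_left]

lemma inner_toFock_self (n : ℕ) (x y : TPow H n) :
    inner ℂ (toFock q n x) (toFock q n y) = inner ℂ x (lam (q : ℝ) n y) := by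
  rw [inner_toFock_right, toFock_apply, LinearIsometryEquiv.apply_symm_apply,
    lp.single_apply_self, inner_toParticle]

/-- Vectors in the kernel of `λₙ` are null for the semi-inner product, hence vanish in the
completion. -/
lemma toFock_eq_zero (n : ℕ) {x : TPow H n} (h : lam (q : ℝ) n x = 0) : toFock q n x = 0 := by
  rw [← inner_self_eq_zero (𝕜 := ℂ), inner_toFock_self, h, inner_zero_right]

lemma inner_vacuum_vacuum : inner ℂ (vacuum H q) (vacuum H q) = (1 : ℂ) := by
  rw [vacuum_eq_toFock, inner_toFock_self]
  change inner ℂ (1 : ℂ) (1 : ℂ) = 1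
  simp

lemma norm_vacuum : ‖vacuum H q‖ = 1 := by
  rw [norm_eq_sqrt_re_inner (𝕜 := ℂ), inner_vacuum_vacuum, RCLike.one_re, Real.sqrt_one]

lemma fockEquiv_creation_zero (f : H) (w : Fock H q) :
    fockEquiv H q (creation q f w) 0 = 0 := rfl

lemma fockEquiv_creation_succ (f : H) (w : Fock H q) (n : ℕ) :
    fockEquiv H q (creation q f w) (n + 1) = creationAt q n f (fockEquiv H q w n) := rfl

lemma creation_toFock (f : H) (n : ℕ) (x : TPow H n) :
    creation q f (toFock q n x) = toFock q (n + 1) (tensorLeft f n x) := by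
  apply (fockEquiv H q).injective
  ext m
  rw [toFock_apply, toFock_apply, LinearIsometryEquiv.apply_symm_apply]
  cases m with
  | zero => rw [fockEquiv_creation_zero, lp.single_apply_ne _ _ _ (by omega)]
  | succ m =>
    rw [fockEquiv_creation_succ, LinearIsometryEquiv.apply_symm_apply]
    rcases eq_or_ne m n with rfl | h
    · rw [lp.single_apply_self, lp.single_apply_self, creationAt_toParticle]
    · rw [lp.single_apply_ne _ _ _ h, lp.single_apply_ne _ _ _ (by omega), map_zero]

lemma annihilation_vacuum (f : H) : annihilation q f (vacuum H q) = 0 := by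
  refine ext_inner_left ℂ fun w => ?_
  rw [annihilation, ContinuousLinearMap.adjoint_inner_right, vacuum_eq_toFock,
    inner_toFock_right, fockEquiv_creation_zero, inner_zero_left, inner_zero_right]

/-- Reduces the adjoint to algebra: only the `n`-th component of a test vector contributes, and the
tensor power is dense in `𝓗ₙ`. -/
lemma annihilation_toFock_succ (f : H) (n : ℕ) (x : TPow H (n + 1)) (y : TPow H n)
    (h : ∀ F : TPow H n, inner ℂ (tensorLeft f n F) (lam (q : ℝ) (n + 1) x)
      = inner ℂ F (lam (q : ℝ) n y)) :
    annihilation q f (toFock q (n + 1) x) = toFock q n y := by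
  refine ext_inner_left ℂ fun w => ?_
  rw [annihilation, ContinuousLinearMap.adjoint_inner_right, inner_toFock_right,
    inner_toFock_right, fockEquiv_creation_succ]
  have hdense : DenseRange (toParticle (H := H) q n) :=
    UniformSpace.Completion.denseRange_coe (α := PreParticle H q n)
  refine hdense.induction_on (p := fun w => inner ℂ (creationAt q n f w)
    (toParticle q (n + 1) x) = inner ℂ w (toParticle q n y)) (fockEquiv H q w n) ?_ ?_
  · exact isClosed_eq (by fun_prop) (by fun_prop)
  · intro F
    rw [creationAt_toParticle, inner_toParticle, inner_toParticle, h]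

/-- The tensor power `f ⊗ … ⊗ f` of a vector. -/
noncomputable def vecPow (f : H) : (n : ℕ) → TPow H n
  | 0 => unit H
  | n + 1 => tensorLeft f n (vecPow f n)

lemma creation_toFock_vecPow (f : H) (n : ℕ) :
    creation q f (toFock q n (vecPow f n)) = toFock q (n + 1) (vecPow f (n + 1)) :=
  creation_toFock q f n _

lemma vecPow_one (f : H) : vecPow f 1 = f :=
  one_smul ℂ f

/-- Valid for every `q`, since `λ₀` and `λ₁` are identities; both cases use it. -/
lemma annihilation_toFock_vecPow_one (f : H) :
    annihilation q f (toFock q 1 (vecPow f 1)) = ((‖f‖ : ℂ) ^ 2) • vacuum H q := by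
  rw [vacuum_eq_toFock, ← map_smul]
  refine annihilation_toFock_succ q f 0 _ _ fun F => ?_
  rw [vecPow_one, map_smul, inner_smul_right]
  change inner ℂ (F.down • f) f = (‖f‖ : ℂ) ^ 2 * inner ℂ F.down (1 : ℂ)
  rw [inner_smul_left, inner_self_eq_norm_sq_to_K]
  simp [mul_comm]

lemma field_vacuum (f : H) : field q f (vacuum H q) = toFock q 1 (vecPow f 1) := by
  rw [field, add_apply, annihilation_vacuum, zero_add, vacuum_eq_toFock]
  exact creation_toFock_vecPow q f 0

lemma lastTwo_one_zero : ∀ n : ℕ, lastTwo (H := H) 1 0 n = LinearMap.id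
  | 0 => rfl
  | 1 => rfl
  | 2 => by
    change flipComb (H := H) 1 0 = LinearMap.id
    simp [flipComb]
  | n + 3 => by
    change LinearMap.lTensor H (lastTwo (H := H) 1 0 (n + 2)) = LinearMap.id
    rw [lastTwo_one_zero (n + 2), LinearMap.lTensor_id]

/-- Without the twist, the inner product factorises and removing the leading `f` costs `⟨f, f⟩`. -/
lemma annihilation_toFock_vecPow_of_eq_zero (hq : (q : ℝ) = 0) (f : H) : ∀ n : ℕ,
    annihilation q f (toFock q (n + 1) (vecPow f (n + 1)))
      = ((‖f‖ : ℂ) ^ 2) • toFock q n (vecPow f n)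
  | 0 => annihilation_toFock_vecPow_one q f
  | n + 1 => by
    rw [← map_smul]
    refine annihilation_toFock_succ q f (n + 1) _ _ fun F => ?_
    rw [hq, lam, lam, lastTwo_one_zero, lastTwo_one_zero, LinearMap.id_apply, LinearMap.id_apply,
      inner_smul_right]
    change inner ℂ (f ⊗ₜ[ℂ] F) (f ⊗ₜ[ℂ] vecPow f (n + 1)) = _
    rw [TensorProduct.inner_tmul, inner_self_eq_norm_sq_to_K]
    rfl

/-- `λ₂ (f ⊗ f) = (1 + q) f ⊗ f` vanishes at `q = -1`. -/
lemma toFock_vecPow_two_of_eq_neg_one (hq : (q : ℝ) = -1) (f : H) :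
    toFock q 2 (vecPow f 2) = 0 := by
  apply toFock_eq_zero
  rw [hq]
  change flipComb 1 (-1) (f ⊗ₜ[ℂ] (vecPow f 1 : H)) = 0
  rw [vecPow_one]
  simp [flipComb]

/-! ### The vacuum moments -/

lemma field_field_vacuum_of_eq_neg_one (hq : (q : ℝ) = -1) (f : H) :
    field q f (field q f (vacuum H q)) = ((‖f‖ : ℂ) ^ 2) • vacuum H q := by
  rw [field_vacuum, field, add_apply, creation_toFock_vecPow,
    toFock_vecPow_two_of_eq_neg_one q hq, add_zero, annihilation_toFock_vecPow_one]

lemma moment_of_eq_neg_one (hq : (q : ℝ) = -1) (f : H) (n : ℕ) :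
    inner ℂ (vacuum H q) ((field q f ^ n) (vacuum H q))
      = ((((-‖f‖) ^ n + ‖f‖ ^ n) / 2 : ℝ) : ℂ) := by
  have heven : ∀ k : ℕ, (field q f ^ (2 * k)) (vacuum H q)
      = ((‖f‖ : ℂ) ^ (2 * k)) • vacuum H q := by
    intro k
    induction k with
    | zero => simp
    | succ k ih =>
      rw [show 2 * (k + 1) = 2 * k + 1 + 1 by ring, pow_succ, pow_succ]
      simp only [mul_apply_eq_comp]
      rw [field_field_vacuum_of_eq_neg_one q hq, map_smul, ih, smul_smul]
      congr 1
      ring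
  rcases Nat.even_or_odd' n with ⟨k, rfl | rfl⟩
  · rw [heven, inner_smul_right, inner_vacuum_vacuum]
    simp [pow_mul]
  -- An odd power sends the vacuum into the one-particle space, orthogonal to it; on the other side
  -- `(-‖f‖)ⁿ` and `‖f‖ⁿ` cancel.
  · rw [pow_succ', mul_apply_eq_comp, heven, map_smul, inner_smul_right, field_vacuum,
      vacuum_eq_toFock, inner_toFock_of_ne q (by omega)]
    simp [pow_succ, pow_mul]

/-- The Chebyshev model of `Q(f)`; one factor of `sin² θ` has cancelled the denominator of
`sin((n+1)θ) / sin θ`. Only `n = 0` is wanted in the end, but the induction on `m` moves `n` to `n ±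
1`. -/
lemma inner_vacuum_field_pow_of_eq_zero (hq : (q : ℝ) = 0) (f : H) (m n : ℕ) :
    inner ℂ (vacuum H q) ((field q f ^ m) (toFock q n (vecPow f n)))
      = ((2 / Real.pi * ∫ θ in 0..Real.pi, (2 * ‖f‖ * Real.cos θ) ^ m
          * (‖f‖ ^ n * Real.sin ((n + 1) * θ)) * Real.sin θ : ℝ) : ℂ) := by
  induction m generalizing n with
  | zero =>
    simp only [pow_zero, one_mul, mul_assoc]
    rw [intervalIntegral.integral_const_mul, integral_sin_succ_mul_sin,
      one_apply_eq_self]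
    split_ifs with h
    · subst h
      rw [vecPow, ← vacuum_eq_toFock, inner_vacuum_vacuum, ← Complex.ofReal_one]
      congr 1
      field_simp
    · rw [vacuum_eq_toFock, inner_toFock_of_ne q (Ne.symm h)]
      simp
  | succ m ih =>
    rw [pow_succ, mul_apply_eq_comp]
    cases n with
    | zero =>
      rw [vecPow, ← vacuum_eq_toFock, field_vacuum, ih 1]
      congr 3
      ext θ
      -- Bottom of the recurrence, with no annihilation term: `2 cos θ sin θ = sin 2θ`.
      rw [show ((1 : ℕ) + 1 : ℝ) * θ = 2 * θ by norm_num, Real.sin_two_mul]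
      simp only [CharP.cast_eq_zero, zero_add, one_mul, pow_zero, pow_one]
      ring
    | succ n =>
      rw [field, add_apply, annihilation_toFock_vecPow_of_eq_zero q hq,
        creation_toFock_vecPow, ← field, map_add, map_smul, inner_add_right, inner_smul_right,
        ih, ih, ← Complex.ofReal_pow, ← Complex.ofReal_mul, ← Complex.ofReal_add]
      congr 1
      rw [mul_left_comm, ← mul_add, ← intervalIntegral.integral_const_mul,
        ← intervalIntegral.integral_add (Continuous.intervalIntegrable (by fun_prop) _ _)
          (Continuous.intervalIntegrable (by fun_prop) _ _)]
      congr 2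
      ext θ
      -- Three-term recurrence: `sin((n+3)θ) + sin((n+1)θ) = 2 cos θ sin((n+2)θ)`, expanded around
      -- the middle angle.
      have h1 : ((n + 1 + 1 : ℕ) + 1 : ℝ) * θ = ((n + 1 : ℕ) + 1) * θ + θ := by push_cast; ring
      have h2 : ((n : ℝ) + 1) * θ = ((n + 1 : ℕ) + 1) * θ - θ := by push_cast; ring
      rw [h1, h2, Real.sin_add, Real.sin_sub]
      ring

lemma moment_of_eq_zero (hq : (q : ℝ) = 0) (f : H) (n : ℕ) :
    inner ℂ (vacuum H q) ((field q f ^ n) (vacuum H q))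
      = ((2 / Real.pi * ∫ θ in 0..Real.pi,
          (2 * ‖f‖ * Real.cos θ) ^ n * Real.sin θ ^ 2 : ℝ) : ℂ) := by
  have h := inner_vacuum_field_pow_of_eq_zero q hq f n 0
  rw [vecPow, ← vacuum_eq_toFock] at h
  rw [h]
  congr 3
  ext θ
  simp
  ring

end

end Q2Fock

theorem proposition3p1 {H : Type*} [NormedAddCommGroup H] [InnerProductSpace ℂ H]
    [CompleteSpace H] (q : Set.Icc (-1 : ℝ) 1) (f : H) (hf : f ≠ 0) :
    ((q : ℝ) = -1 →
      Q2Fock.IsDistribution (Q2Fock.field q f) (Q2Fock.vacuum H q) (Q2Fock.twoPointLaw ‖f‖)) ∧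
    ((q : ℝ) = 0 →
      Q2Fock.IsDistribution (Q2Fock.field q f) (Q2Fock.vacuum H q)
        (Q2Fock.semicircleLaw (2 * ‖f‖))) := by
  have hpos : 0 < 2 * ‖f‖ := by positivity
  refine ⟨fun hq => ?_, fun hq => ?_⟩
  · refine Q2Fock.IsDistribution.of_moments (Q2Fock.norm_vacuum q)
      (Q2Fock.isSelfAdjoint_field q f) (Q2Fock.isProbabilityMeasure_twoPointLaw _)
      (Q2Fock.ae_twoPointLaw (norm_nonneg f)) fun n => ?_
    rw [Q2Fock.moment_of_eq_neg_one q hq, Q2Fock.integral_twoPointLaw]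
  · refine Q2Fock.IsDistribution.of_moments (Q2Fock.norm_vacuum q)
      (Q2Fock.isSelfAdjoint_field q f) (Q2Fock.isProbabilityMeasure_semicircleLaw hpos)
      (Q2Fock.ae_semicircleLaw _) fun n => ?_
    rw [Q2Fock.moment_of_eq_zero q hq, Q2Fock.integral_semicircleLaw hpos (by fun_prop)]
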